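/- All graphs are finite and simple. For an automorphism $\beta$ of a graph $H$, let $|\beta|$ be the number of cycles of $\beta$ as a permutation of $V(H)$ and $|\beta|_e$ the number of cycles of the permutation $uv\mapsto\beta(u)\beta(v)$ of $E(H)$; fixed vertices and fixed edges count as cycles of length one. An edge coloring of $H$ (not necessarily proper) is distinguishing if the identity is the only automorphism of $H$ that preserves the color of every edge. The edge-distinguishing threshold $\theta'(H)$ is the least positive integer $m$ such that every edge coloring of $H$ that uses exactly $m$ colors is distinguishing. A graph is prime (with respect to the Cartesian product $\square$) if it has at least two vertices and is not isomorphic to a Cartesian product of two graphs with at least two vertices each. Theorem 5.1. Let $k\ge 2$, let $G_1,\dots,G_k$ be connected, prime, pairwise non-isomorphic graphs, and let $G=G_1\square\cdots\square G_k$. For each $i$ let $Q_i=G_1\square\cdots\square G_{i-1}\square G_{i+1}\square\cdots\square G_k$ be the Cartesian product of the other factors. Then $$\theta'(G)=\max\bigl\{\,|\beta|_e\cdot|V(Q_i)|+|\beta|\cdot|E(Q_i)| \;:\; i=1,\dots,k,\ \beta\in\mathrm{Aut}(G_i)\setminus\{\mathrm{id}\}\,\bigr\}+1,$$ where the maximum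 of the empty set is taken to be $0$ (this occurs when no $G_i$ has a non-identity automorphism). -/

import Mathlib

/-- The number of cycles of a permutation of a finite set, cycles of length one (fixed points)
included. -/
noncomputable def Equiv.Perm.numCycles {α : Type*} (σ : Equiv.Perm α) : ℕ :=
  Nat.card (Quotient (Equiv.Perm.SameCycle.setoid σ))

namespace SimpleGraph

/-- The number `|β|` of cycles of an automorphism `β` on the vertices. -/
noncomputable def vertexCycles {V : Type*} {G : SimpleGraph V} (β : G ≃g G) : ℕ :=
  Equiv.Perm.numCycles β.toEquiv

/-- The number `|β|ₑ` of cycles on the edge set of the permutation `uv ↦ β(u)β(v)` induced by an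
automorphism `β`. -/
noncomputable def edgeCycles {V : Type*} {G : SimpleGraph V} (β : G ≃g G) : ℕ :=
  Equiv.Perm.numCycles β.mapEdgeSet

/-- An edge coloring (not necessarily proper) is distinguishing if the identity is the only
automorphism that preserves the color of every edge. -/
def IsEdgeDistinguishing {V C : Type*} (G : SimpleGraph V) (c : G.edgeSet → C) : Prop :=
  ∀ α : G ≃g G, (∀ e : G.edgeSet, c (α.mapEdgeSet e) = c e) → α = RelIso.refl G.Adj

/-- The positive integers `k` such that every edge coloring that uses exactly `k` colors
is distinguishing. -/
def edgeDistinguishingNumbers {V : Type*} (G : SimpleGraph V) : Set ℕ :=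
  {k | 1 ≤ k ∧ ∀ c : G.edgeSet → Fin k, Function.Surjective c → G.IsEdgeDistinguishing c}

/-- The edge-distinguishing threshold `θ'(G)`: the least positive integer `k` such that every edge
coloring with exactly `k` colors is distinguishing. -/
noncomputable def edgeDistinguishingThreshold {V : Type*} (G : SimpleGraph V) : ℕ :=
  sInf G.edgeDistinguishingNumbers

/-- For a finite graph the infimum in the definition of the threshold is a minimum. -/
theorem edgeDistinguishingThreshold_isLeast {V : Type*} [Finite V] (G : SimpleGraph V) :
    IsLeast G.edgeDistinguishingNumbers G.edgeDistinguishingThreshold := by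
  have hne : G.edgeDistinguishingNumbers.Nonempty := by
    refine ⟨Nat.card G.edgeSet + 1, by omega, fun c hc => ?_⟩
    have h := Nat.card_le_card_of_surjective c hc
    rw [Nat.card_eq_fintype_card (α := Fin _), Fintype.card_fin] at h
    omega
  exact ⟨Nat.sInf_mem hne, fun k hk => Nat.sInf_le hk⟩

/-- The Cartesian product of a family of graphs: two vertices are adjacent if they are adjacent in
one coordinate and agree in all the others. -/
def cartesianProduct {ι : Type*} {V : ι → Type*} (G : ∀ i, SimpleGraph (V i)) :
    SimpleGraph (∀ i, V i) where
  Adj x y := ∃ i, (G i).Adj (x i) (y i) ∧ ∀ j, j ≠ i → x j = y j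
  symm := ⟨fun _ _ ⟨i, h, h'⟩ => ⟨i, h.symm, fun j hj => (h' j hj).symm⟩⟩
  loopless := ⟨fun _ ⟨_, h, _⟩ => h.ne rfl⟩

/-- The quotient graph `Q_i`: the Cartesian product of all factors except the `i`-th. -/
def cartesianQuotient {ι : Type*} {V : ι → Type*} (G : ∀ i, SimpleGraph (V i)) (i : ι) :
    SimpleGraph (∀ j : {j : ι // j ≠ i}, V j) :=
  cartesianProduct fun j : {j : ι // j ≠ i} => G j

/-- A graph is prime (with respect to the Cartesian product) if it has at least two vertices and is
not isomorphic to the Cartesian product of two graphs with at least two vertices each. -/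
def IsCartesianPrime.{u} {V : Type u} (G : SimpleGraph V) : Prop :=
  Nontrivial V ∧ ∀ (A B : Type u) (H : SimpleGraph A) (K : SimpleGraph B),
    Nonempty (G ≃g H □ K) → Subsingleton A ∨ Subsingleton B

/-- All values `|β|ₑ |V(Q_i)| + |β| |E(Q_i)|`, for a factor `G_i` and a non-identity automorphism
`β` of `G_i`. -/
def factorCycleCounts {ι : Type*} {V : ι → Type*} (G : ∀ i, SimpleGraph (V i)) : Set ℕ :=
  {n | ∃ (i : ι) (β : G i ≃g G i), β ≠ RelIso.refl (G i).Adj ∧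
    n = edgeCycles β * Nat.card (∀ j : {j : ι // j ≠ i}, V j) +
      vertexCycles β * Nat.card (cartesianQuotient G i).edgeSet}

/-- For finitely many finite factors there are only finitely many values, so that the supremum of a
non-empty set of them is a maximum. -/
theorem factorCycleCounts_finite {ι : Type*} [Finite ι] {V : ι → Type*} [∀ i, Finite (V i)]
    (G : ∀ i, SimpleGraph (V i)) : (factorCycleCounts G).Finite := by
  have hfin : ∀ i, Finite (G i ≃g G i) := fun i =>
    Finite.of_injective (fun β : G i ≃g G i => (β : V i → V i)) DFunLike.coe_injective
  refine (Set.finite_range fun p : Σ i, (G i ≃g G i) =>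
    edgeCycles p.2 * Nat.card (∀ j : {j : ι // j ≠ p.1}, V j) +
      vertexCycles p.2 * Nat.card (cartesianQuotient G p.1).edgeSet).subset ?_
  rintro n ⟨i, β, -, rfl⟩
  exact ⟨⟨i, β⟩, rfl⟩

end SimpleGraph

/-!
A coloring of the edges is preserved by an automorphism `α` exactly when it is constant on the
cycles of `α` on the edge set. Hence `α` preserves some coloring with exactly `m ≥ 1` colors if and
only if `m` is at most the number of these cycles, and the threshold of a finite graph is one more
than the largest number of edge cycles of a non-identity automorphism
(`edgeDistinguishingThreshold_eq`).

For the product `G` of the family, every automorphism acts coordinatewise (a case of the theorem of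
Sabidussi and Vizing, `apply_update_eq` and `apply_coord_eq`). Call the set of vertices that differ
from `x` in coordinate `i` only a *layer*. A layer contains every vertex on a geodesic between two
of its points, so its image under an automorphism has the same property. Distances in a product add
up over the coordinates, so a set with this property is closed under combining coordinates of two
of its points, that is, it is a box. This box is isomorphic to the prime graph `G i`, so it has only
one nontrivial side (`IsCartesianPrime.fst_or_snd_const`) and lies in a layer of some direction `j`.
Applying the inverse automorphism shows that it is the whole of that layer, so `G i` is isomorphic
to `G j`, and `i = j` since the factors are pairwise non-isomorphic.

It remains to count. Given a non-identity automorphism, choose a coordinate `i` on which it acts as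
`β ≠ id`, and write `G` as the product of `G i` and the quotient `Q`; the automorphism is then a
pair `(β, γ)`. The edges of `G` are the pairs (edge of `G i`, vertex of `Q`) and the pairs
(vertex of `G i`, edge of `Q`). A product permutation `σ × τ` on `X × Y` has at most
`numCycles σ * |Y|` cycles, because every cycle meets `{x} × Y` for `x` in a set of representatives
of the cycles of `σ`, with equality if `τ = id`. So the number of edge cycles of `(β, γ)` is at most
the value belonging to `β` (`edgeCycles_le_of_boxProd`), which is attained by `(β, id)`
(`le_edgeCycles_of_boxProd`).
-/

/-! ### Counting cycles of permutations -/

namespace Equiv.Perm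

/-- An invariant of `σ` that takes all values in `C` distinguishes at least `|C|` cycles. -/
theorem card_le_numCycles {A C : Type*} [Finite A] (σ : Perm A) (F : A → C)
    (hF : Function.Surjective F) (hσ : ∀ a, F (σ a) = F a) : Nat.card C ≤ numCycles σ := by
  have hz : ∀ (n : ℤ) (a : A), F ((σ ^ n) a) = F a := by
    intro n
    induction n using Int.induction_on with
    | zero => simp
    | succ n ih => intro a; rw [zpow_add_one, mul_apply, ih, hσ]
    | pred n ih =>
      intro a
      rw [zpow_sub_one, mul_apply, ih, ← hσ]
      simp
  let f : Quotient (SameCycle.setoid σ) → C :=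
    Quotient.lift F (by rintro a b ⟨n, rfl⟩; exact (hz n a).symm)
  exact Nat.card_le_card_of_surjective f fun c => by
    obtain ⟨a, rfl⟩ := hF c
    exact ⟨Quotient.mk _ a, rfl⟩

/-- A family of points that meets every cycle of `σ` bounds the number of cycles. -/
theorem numCycles_le_card {A C : Type*} [Finite C] (σ : Perm A) (g : C → A)
    (hg : ∀ a, ∃ c, SameCycle σ (g c) a) : numCycles σ ≤ Nat.card C :=
  Nat.card_le_card_of_surjective (fun c => Quotient.mk (SameCycle.setoid σ) (g c)) fun q => by
    induction q using Quotient.ind with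
    | _ a =>
      obtain ⟨c, hc⟩ := hg a
      exact ⟨c, Quotient.sound hc⟩

theorem zpow_semiconj {A B : Type*} {σ : Perm A} {τ : Perm B} {f : A → B}
    (h : ∀ a, f (σ a) = τ (f a)) (n : ℤ) (a : A) : f ((σ ^ n) a) = (τ ^ n) (f a) := by
  induction n using Int.induction_on generalizing a with
  | zero => simp
  | succ n ih => rw [zpow_add_one, zpow_add_one, mul_apply, mul_apply, ih, h]
  | pred n ih =>
    rw [zpow_sub_one, zpow_sub_one, mul_apply, mul_apply, ih]
    congr 1
    rw [eq_inv_iff_eq, ← h]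
    simp

theorem prodCongr_zpow_apply {A B : Type*} (σ : Perm A) (τ : Perm B) (n : ℤ) (p : A × B) :
    (Equiv.prodCongr σ τ ^ n) p = ((σ ^ n) p.1, (τ ^ n) p.2) :=
  Prod.ext (zpow_semiconj (σ := Equiv.prodCongr σ τ) (τ := σ) (f := Prod.fst) (fun _ => rfl) n p)
    (zpow_semiconj (σ := Equiv.prodCongr σ τ) (τ := τ) (f := Prod.snd) (fun _ => rfl) n p)

theorem sameCycle_out {A : Type*} (σ : Perm A) (a : A) :
    SameCycle σ (Quotient.mk (SameCycle.setoid σ) a).out a :=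
  Quotient.exact (s := SameCycle.setoid σ) (Quotient.out_eq (Quotient.mk _ a))

theorem mk_apply {A : Type*} (σ : Perm A) (a : A) :
    Quotient.mk (SameCycle.setoid σ) (σ a) = Quotient.mk (SameCycle.setoid σ) a :=
  Quotient.sound (sameCycle_apply_left.2 (SameCycle.refl σ a))

section SumProd

variable {A B C D E : Type*} [Finite A] [Finite B] [Finite C] [Finite D]

/-- If `π` acts on a disjoint union `A × B ⊕ C × D` as `σ × τ` on the first part and as `ρ × υ` on the
second, then every cycle meets a fiber over a chosen representative of a cycle of `σ` or `ρ`. -/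
theorem numCycles_le_of_sum_prod (π : Perm E) (σ : Perm A) (τ : Perm B) (ρ : Perm C) (υ : Perm D)
    (e : A × B ⊕ C × D ≃ E)
    (hl : ∀ a b, π (e (.inl (a, b))) = e (.inl (σ a, τ b)))
    (hr : ∀ c d, π (e (.inr (c, d))) = e (.inr (ρ c, υ d))) :
    numCycles π ≤ numCycles σ * Nat.card B + numCycles ρ * Nat.card D := by
  have hcard : Nat.card (Quotient (SameCycle.setoid σ) × B ⊕ Quotient (SameCycle.setoid ρ) × D) =
      numCycles σ * Nat.card B + numCycles ρ * Nat.card D := by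
    simp [numCycles, Nat.card_sum, Nat.card_prod]
  rw [← hcard]
  have hl' := zpow_semiconj (σ := Equiv.prodCongr σ τ) (τ := π) (f := fun p => e (.inl p))
    fun p => (hl p.1 p.2).symm
  have hr' := zpow_semiconj (σ := Equiv.prodCongr ρ υ) (τ := π) (f := fun p => e (.inr p))
    fun p => (hr p.1 p.2).symm
  refine numCycles_le_card π
    (fun c => e (c.map (fun p => (p.1.out, p.2)) (fun p => (p.1.out, p.2)))) fun x => ?_
  obtain ⟨x, rfl⟩ := e.surjective x
  rcases x with ⟨a, b⟩ | ⟨c, d⟩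
  · obtain ⟨n, hn⟩ := sameCycle_out σ a
    refine ⟨.inl (Quotient.mk _ a, (τ ^ n).symm b), n, ?_⟩
    refine (hl' n _).symm.trans (congrArg (fun p => e (.inl p)) ?_)
    rw [prodCongr_zpow_apply]
    exact Prod.ext hn ((τ ^ n).apply_symm_apply b)
  · obtain ⟨n, hn⟩ := sameCycle_out ρ c
    refine ⟨.inr (Quotient.mk _ c, (υ ^ n).symm d), n, ?_⟩
    refine (hr' n _).symm.trans (congrArg (fun p => e (.inr p)) ?_)
    rw [prodCongr_zpow_apply]
    exact Prod.ext hn ((υ ^ n).apply_symm_apply d)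

/-- The bound of `numCycles_le_of_sum_prod` is attained if the second components are fixed: the pair
consisting of the cycle of the first component and the second component is then an invariant. -/
theorem le_numCycles_of_sum_prod (π : Perm E) (σ : Perm A) (ρ : Perm C) (e : A × B ⊕ C × D ≃ E)
    (hl : ∀ a b, π (e (.inl (a, b))) = e (.inl (σ a, b)))
    (hr : ∀ c d, π (e (.inr (c, d))) = e (.inr (ρ c, d))) :
    numCycles σ * Nat.card B + numCycles ρ * Nat.card D ≤ numCycles π := by
  have hcard : Nat.card (Quotient (SameCycle.setoid σ) × B ⊕ Quotient (SameCycle.setoid ρ) × D) =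
      numCycles σ * Nat.card B + numCycles ρ * Nat.card D := by
    simp [numCycles, Nat.card_sum, Nat.card_prod]
  have : Finite E := Finite.of_equiv _ e
  rw [← hcard]
  refine card_le_numCycles π (fun x => (e.symm x).map (fun p => (Quotient.mk _ p.1, p.2))
    (fun p => (Quotient.mk _ p.1, p.2))) ?_ fun x => ?_
  · refine Function.Surjective.comp (g := Sum.map _ _) (Sum.map_surjective.2 ⟨?_, ?_⟩) e.symm.surjective
    · rintro ⟨q, b⟩
      exact ⟨(q.out, b), Prod.ext (Quotient.out_eq q) rfl⟩
    · rintro ⟨q, b⟩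
      exact ⟨(q.out, b), Prod.ext (Quotient.out_eq q) rfl⟩
  · obtain ⟨x, rfl⟩ := e.surjective x
    rcases x with ⟨a, b⟩ | ⟨c, d⟩
    · simp [hl, mk_apply]
    · simp [hr, mk_apply]

end SumProd

end Equiv.Perm

namespace SimpleGraph

/-! ### The threshold and the edge cycles of automorphisms -/

/-- The threshold is determined by the largest number `N` of edge cycles of a non-identity
automorphism. The case `N = 0` covers graphs without non-identity automorphisms. -/
theorem edgeDistinguishingThreshold_eq {V : Type*} [Finite V] (G : SimpleGraph V) (N : ℕ)
    (hle : ∀ α : G ≃g G, α ≠ RelIso.refl G.Adj → edgeCycles α ≤ N)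
    (hex : N ≠ 0 → ∃ α : G ≃g G, α ≠ RelIso.refl G.Adj ∧ N ≤ edgeCycles α) :
    G.edgeDistinguishingThreshold = N + 1 := by
  refine (edgeDistinguishingThreshold_isLeast G).unique ⟨⟨by omega, fun c hc α hα => ?_⟩, ?_⟩
  · by_contra hne
    have h := Equiv.Perm.card_le_numCycles α.mapEdgeSet c hc hα
    have h' : Equiv.Perm.numCycles α.mapEdgeSet ≤ N := hle α hne
    rw [Nat.card_fin] at h
    omega
  · rintro m ⟨hm, hdist⟩
    by_contra! hlt
    obtain ⟨α, hne, hN⟩ := hex (by omega)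
    have hcard : Nat.card (Fin m) ≤ edgeCycles α := by rw [Nat.card_fin]; omega
    have : Nonempty (Fin m) := ⟨⟨0, hm⟩⟩
    obtain ⟨f⟩ : Nonempty (Fin m ↪ Quotient (Equiv.Perm.SameCycle.setoid α.mapEdgeSet)) := by
      have := Fintype.ofFinite (Quotient (Equiv.Perm.SameCycle.setoid α.mapEdgeSet))
      refine Function.Embedding.nonempty_of_card_le ?_
      rwa [← Nat.card_eq_fintype_card, ← Nat.card_eq_fintype_card]
    refine hne (hdist (fun e => Function.invFun f (Quotient.mk _ e)) ?_ α fun e => ?_)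
    · exact (Function.invFun_surjective f.injective).comp Quotient.mk_surjective
    · exact congrArg _ (Equiv.Perm.mk_apply _ e)

/-! ### Edges of a Cartesian product of two graphs -/

section BoxProd

variable {V A B : Type*} {G : SimpleGraph V} {H : SimpleGraph A} {K : SimpleGraph B}

/-- An edge of one factor and a vertex of the other determine an edge of the Cartesian product. -/
def boxProdEdgeMap (H : SimpleGraph A) (K : SimpleGraph B) :
    H.edgeSet × B ⊕ A × K.edgeSet → (H □ K).edgeSet
  | .inl (e, b) => (H.boxProdLeft K b).mapEdgeSet e
  | .inr (a, e) => (H.boxProdRight K a).mapEdgeSet e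

theorem boxProdEdgeMap_bijective (H : SimpleGraph A) (K : SimpleGraph B) :
    Function.Bijective (boxProdEdgeMap H K) := by
  constructor
  · rintro (⟨⟨e, he⟩, b⟩ | ⟨a, ⟨e, he⟩⟩) (⟨⟨e', he'⟩, b'⟩ | ⟨a', ⟨e', he'⟩⟩) h <;>
      induction e with | _ x y <;> induction e' with | _ x' y' <;>
      replace h := congrArg Subtype.val h <;>
      simp [boxProdEdgeMap, Hom.mapEdgeSet] at h he he' ⊢
    · tauto
    · obtain ⟨⟨rfl, -⟩, rfl, -⟩ | ⟨⟨rfl, -⟩, rfl, -⟩ := h <;> exact he.ne rfl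
    · obtain ⟨⟨rfl, -⟩, rfl, -⟩ | ⟨⟨rfl, -⟩, rfl, -⟩ := h <;> exact he'.ne rfl
    · tauto
  · rintro ⟨e, he⟩
    induction e with | _ x y
    obtain ⟨a, b⟩ := x
    obtain ⟨a', b'⟩ := y
    rcases boxProd_adj.1 he with ⟨h, h'⟩ | ⟨h, h'⟩
    · obtain rfl : b = b' := h'
      exact ⟨.inl (⟨s(a, a'), h⟩, b), rfl⟩
    · obtain rfl : a = a' := h'
      exact ⟨.inr (a, ⟨s(b, b'), h⟩), rfl⟩

/-- Every edge of `H □ K` is, in a unique way, a copy of an edge of `H` over a vertex of `K` or a copy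
of an edge of `K` over a vertex of `H`. -/
noncomputable def boxProdEdgeEquiv (H : SimpleGraph A) (K : SimpleGraph B) :
    H.edgeSet × B ⊕ A × K.edgeSet ≃ (H □ K).edgeSet :=
  Equiv.ofBijective _ (boxProdEdgeMap_bijective H K)

theorem mapEdgeSet_boxProdEdgeEquiv_inl (φ : G ≃g H □ K) (α : G ≃g G) (β : H ≃g H) (γ : K ≃g K)
    (h : ∀ x, φ (α x) = (β (φ x).1, γ (φ x).2)) (e : H.edgeSet) (b : B) :
    α.mapEdgeSet (φ.symm.mapEdgeSet (boxProdEdgeEquiv H K (.inl (e, b)))) =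
      φ.symm.mapEdgeSet (boxProdEdgeEquiv H K (.inl (β.mapEdgeSet e, γ b))) := by
  have h' : ∀ y, α (φ.symm y) = φ.symm (β y.1, γ y.2) := fun y => by
    rw [← φ.symm_apply_apply (α _), h, φ.apply_symm_apply]
  obtain ⟨e, he⟩ := e
  induction e with | _ x y
  exact Subtype.ext (congrArg₂ (fun p q => s(p, q)) (h' (x, b)) (h' (y, b)))

theorem mapEdgeSet_boxProdEdgeEquiv_inr (φ : G ≃g H □ K) (α : G ≃g G) (β : H ≃g H) (γ : K ≃g K)
    (h : ∀ x, φ (α x) = (β (φ x).1, γ (φ x).2)) (a : A) (e : K.edgeSet) :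
    α.mapEdgeSet (φ.symm.mapEdgeSet (boxProdEdgeEquiv H K (.inr (a, e)))) =
      φ.symm.mapEdgeSet (boxProdEdgeEquiv H K (.inr (β a, γ.mapEdgeSet e))) := by
  have h' : ∀ y, α (φ.symm y) = φ.symm (β y.1, γ y.2) := fun y => by
    rw [← φ.symm_apply_apply (α _), h, φ.apply_symm_apply]
  obtain ⟨e, he⟩ := e
  induction e with | _ x y
  exact Subtype.ext (congrArg₂ (fun p q => s(p, q)) (h' (a, x)) (h' (a, y)))

theorem edgeCycles_le_of_boxProd [Finite A] [Finite B] (φ : G ≃g H □ K) (α : G ≃g G)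
    (β : H ≃g H) (γ : K ≃g K) (h : ∀ x, φ (α x) = (β (φ x).1, γ (φ x).2)) :
    edgeCycles α ≤ edgeCycles β * Nat.card B + vertexCycles β * Nat.card K.edgeSet :=
  Equiv.Perm.numCycles_le_of_sum_prod α.mapEdgeSet β.mapEdgeSet γ.toEquiv β.toEquiv γ.mapEdgeSet
    ((boxProdEdgeEquiv H K).trans φ.symm.mapEdgeSet)
    (mapEdgeSet_boxProdEdgeEquiv_inl φ α β γ h) (mapEdgeSet_boxProdEdgeEquiv_inr φ α β γ h)

theorem le_edgeCycles_of_boxProd [Finite A] [Finite B] (φ : G ≃g H □ K) (α : G ≃g G)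
    (β : H ≃g H) (h : ∀ x, φ (α x) = (β (φ x).1, (φ x).2)) :
    edgeCycles β * Nat.card B + vertexCycles β * Nat.card K.edgeSet ≤ edgeCycles α := by
  refine Equiv.Perm.le_numCycles_of_sum_prod α.mapEdgeSet β.mapEdgeSet β.toEquiv
    ((boxProdEdgeEquiv H K).trans φ.symm.mapEdgeSet)
    (mapEdgeSet_boxProdEdgeEquiv_inl φ α β (RelIso.refl K.Adj) h) fun a e => ?_
  refine (mapEdgeSet_boxProdEdgeEquiv_inr φ α β (RelIso.refl K.Adj) h a e).trans ?_
  have he : Iso.mapEdgeSet (RelIso.refl K.Adj) e = e := Subtype.ext (congrFun Sym2.map_id _)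
  rw [he]; rfl

/-! ### Automorphisms acting coordinatewise on a product of two graphs -/

/-- The automorphism of `G ≃g H □ K` that acts as `β` on the first coordinate and fixes the
second. -/
def boxProdFstIso (φ : G ≃g H □ K) (β : H ≃g H) : G ≃g G where
  toEquiv := φ.toEquiv.trans ((Equiv.prodCongr β.toEquiv (Equiv.refl B)).trans φ.toEquiv.symm)
  map_rel_iff' := by
    intro x y
    change G.Adj (φ.symm (β (φ x).1, (φ x).2)) (φ.symm (β (φ y).1, (φ y).2)) ↔ _
    rw [φ.symm.map_adj_iff, ← φ.map_adj_iff, boxProd_adj, boxProd_adj]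
    simp [β.map_adj_iff]

theorem apply_boxProdFstIso (φ : G ≃g H □ K) (β : H ≃g H) (x : V) :
    φ (boxProdFstIso φ β x) = (β (φ x).1, (φ x).2) :=
  φ.apply_symm_apply _

/-- An automorphism for which each coordinate of the image depends only on the same coordinate of the
argument is a pair of automorphisms of the factors. -/
theorem exists_boxProd_iso [Finite A] [Finite B] [Nonempty A] [Nonempty B] (φ : G ≃g H □ K)
    (α : G ≃g G) (h₁ : ∀ x y, (φ x).1 = (φ y).1 → (φ (α x)).1 = (φ (α y)).1)
    (h₂ : ∀ x y, (φ x).2 = (φ y).2 → (φ (α x)).2 = (φ (α y)).2) :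
    ∃ (β : H ≃g H) (γ : K ≃g K), ∀ x, φ (α x) = (β (φ x).1, γ (φ x).2) := by
  obtain ⟨a₀⟩ := ‹Nonempty A›
  obtain ⟨b₀⟩ := ‹Nonempty B›
  let f : A → A := fun a => (φ (α (φ.symm (a, b₀)))).1
  let g : B → B := fun b => (φ (α (φ.symm (a₀, b)))).2
  have hfg : ∀ x, φ (α x) = (f (φ x).1, g (φ x).2) := fun x =>
    Prod.ext (h₁ _ _ (by simp)) (h₂ _ _ (by simp))
  have hfg' : ∀ a b, φ (α (φ.symm (a, b))) = (f a, g b) := fun a b => by rw [hfg]; simp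
  have hinj : ∀ a b a' b', f a = f a' → g b = g b' → (a, b) = (a', b') := by
    intro a b a' b' ha hb
    refine φ.symm.injective (α.injective (φ.injective ?_))
    rw [hfg', hfg', ha, hb]
  have hadj : ∀ a b a' b', (H □ K).Adj (f a, g b) (f a', g b') ↔ (H □ K).Adj (a, b) (a', b') := by
    intro a b a' b'
    rw [← hfg', ← hfg', φ.map_adj_iff, α.map_adj_iff, φ.symm.map_adj_iff]
  have hf : Function.Injective f := fun a a' h => congrArg Prod.fst (hinj a b₀ a' b₀ h rfl)
  have hg : Function.Injective g := fun b b' h => congrArg Prod.snd (hinj a₀ b a₀ b' rfl h)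
  refine ⟨⟨Equiv.ofBijective f (Finite.injective_iff_bijective.1 hf), ?_⟩,
    ⟨Equiv.ofBijective g (Finite.injective_iff_bijective.1 hg), ?_⟩, hfg⟩
  · intro a a'
    simpa using hadj a b₀ a' b₀
  · intro b b'
    simpa using hadj a₀ b a₀ b'

/-! ### Geodesics and box-shaped subgraphs -/

theorem Iso.edist_apply_le {W : Type*} {G' : SimpleGraph W} (φ : G ≃g G') (x y : V) :
    G'.edist (φ x) (φ y) ≤ G.edist x y := by
  by_cases h : G.edist x y = ⊤
  · rw [h]; exact le_top
  · obtain ⟨w, hw⟩ := exists_walk_of_edist_ne_top h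
    rw [← hw, ← Walk.length_map φ.toHom w]
    exact edist_le _

theorem Iso.edist_apply {W : Type*} {G' : SimpleGraph W} (φ : G ≃g G') (x y : V) :
    G'.edist (φ x) (φ y) = G.edist x y := by
  refine le_antisymm (φ.edist_apply_le x y) ?_
  simpa using φ.symm.edist_apply_le (φ x) (φ y)

/-- The vertex that takes one coordinate from `x` and the other from `y` lies on a geodesic from `x`
to `y`. -/
theorem edist_boxProd_mix (x y : A × B) :
    (H □ K).edist x (x.1, y.2) + (H □ K).edist (x.1, y.2) y = (H □ K).edist x y := by
  simp [add_comm]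

/-- The copies of `H` in `H □ K` are geodesically convex. Connectedness of `H` is needed because the
equation of distances carries no information if both sides are infinite. -/
theorem snd_eq_of_edist_add_eq (hH : H.Connected) {x y z : A × B} (hxy : x.2 = y.2)
    (h : (H □ K).edist x z + (H □ K).edist z y = (H □ K).edist x y) : z.2 = x.2 := by
  simp only [edist_boxProd, hxy, edist_self, add_zero] at h
  have hle : H.edist x.1 y.1 ≤ H.edist x.1 z.1 + H.edist z.1 y.1 := SimpleGraph.edist_triangle
  have h1 := edist_ne_top_iff_reachable.2 (hH.preconnected x.1 y.1)
  have h2 := edist_ne_top_iff_reachable.2 (hH.preconnected x.1 z.1)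
  have h3 := edist_ne_top_iff_reachable.2 (hH.preconnected z.1 y.1)
  rw [hxy, ← edist_eq_zero_iff (G := K)]
  generalize H.edist x.1 y.1 = p, H.edist x.1 z.1 = q, H.edist z.1 y.1 = r, K.edist z.2 y.2 = s,
    K.edist y.2 z.2 = t at *
  lift p to ℕ using h1
  lift q to ℕ using h2
  lift r to ℕ using h3
  have hs : s ≠ ⊤ := by rintro rfl; simp at h
  have ht : t ≠ ⊤ := by rintro rfl; simp at h
  lift s to ℕ using hs
  lift t to ℕ using ht
  norm_cast at *
  omega

end BoxProd

/-- A copy of a prime graph in `H □ K` that is closed under mixing coordinates is the product of its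
two projections, one of which is then a single vertex. -/
theorem IsCartesianPrime.fst_or_snd_const.{u} {V A B : Type u} {G : SimpleGraph V}
    {H : SimpleGraph A} {K : SimpleGraph B} (hG : G.IsCartesianPrime) (f : G ↪g H □ K)
    (hmix : ∀ u v, ∃ w, f w = ((f u).1, (f v).2)) :
    (∀ u v, (f u).1 = (f v).1) ∨ ∀ u v, (f u).2 = (f v).2 := by
  let S : Set A := Set.range fun u => (f u).1
  let T : Set B := Set.range fun u => (f u).2
  let g : V → S × T := fun u => (⟨(f u).1, u, rfl⟩, ⟨(f u).2, u, rfl⟩)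
  have hg : Function.Bijective g := by
    constructor
    · intro u v h
      exact f.injective (Prod.ext (congrArg (fun p => (p.1 : A)) h)
        (congrArg (fun p => (p.2 : B)) h))
    · rintro ⟨⟨_, u, rfl⟩, ⟨_, v, rfl⟩⟩
      obtain ⟨w, hw⟩ := hmix u v
      have h₁ : (f w).1 = (f u).1 := by rw [hw]
      have h₂ : (f w).2 = (f v).2 := by rw [hw]
      exact ⟨w, Prod.ext (Subtype.ext h₁) (Subtype.ext h₂)⟩
  have φ : G ≃g H.induce S □ K.induce T :=
    { toEquiv := Equiv.ofBijective g hg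
      map_rel_iff' := by
        intro u v
        rw [← f.map_adj_iff, boxProd_adj, boxProd_adj]
        simp [g, Subtype.ext_iff] }
  refine (hG.2 S T _ _ ⟨φ⟩).imp (fun h u v => ?_) fun h u v => ?_
  · exact congrArg Subtype.val (h.elim (⟨_, u, rfl⟩ : S) ⟨_, v, rfl⟩)
  · exact congrArg Subtype.val (h.elim (⟨_, u, rfl⟩ : T) ⟨_, v, rfl⟩)

/-! ### Layers of a Cartesian product -/

section Family

universe u

variable {ι : Type} [DecidableEq ι] {V : ι → Type u} (G : ∀ i, SimpleGraph (V i))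

/-- The product of a family is the product of its `i`-th factor and the quotient graph `Q_i`. -/
def cartesianSplit (i : ι) : cartesianProduct G ≃g G i □ cartesianQuotient G i where
  toEquiv := Equiv.piSplitAt i V
  map_rel_iff' := by
    intro x y
    rw [boxProd_adj]
    constructor
    · rintro (⟨h, h'⟩ | ⟨⟨j, h, hj⟩, h'⟩)
      · exact ⟨i, h, fun j hj => congrFun h' ⟨j, hj⟩⟩
      · refine ⟨j, h, fun l hl => ?_⟩
        by_cases hli : l = i
        · subst hli; exact h'
        · exact hj ⟨l, hli⟩ fun h => hl (congrArg Subtype.val h)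
    · rintro ⟨j, h, hj⟩
      by_cases hji : j = i
      · subst hji
        exact .inl ⟨h, funext fun l => hj l l.2⟩
      · exact .inr ⟨⟨⟨j, hji⟩, h, fun l hl => hj l fun h => hl (Subtype.ext h)⟩,
          hj i (Ne.symm hji)⟩

theorem cartesianSplit_fst (i : ι) (x : ∀ i, V i) : (cartesianSplit G i x).1 = x i := rfl

theorem cartesianSplit_snd_eq_iff (i : ι) (x y : ∀ i, V i) :
    (cartesianSplit G i x).2 = (cartesianSplit G i y).2 ↔ ∀ j, j ≠ i → x j = y j :=
  ⟨fun h j hj => congrFun h ⟨j, hj⟩, fun h => funext fun j => h j j.2⟩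

/-- The layer through `x` in direction `i`: the copy of `G i` obtained by varying the `i`-th coordinate
of `x`. -/
def cartesianLayer (x : ∀ i, V i) (i : ι) : G i ↪g cartesianProduct G where
  toFun := Function.update x i
  inj' := Function.update_injective x i
  map_rel_iff' := by
    intro a b
    change (cartesianProduct G).Adj (Function.update x i a) (Function.update x i b) ↔ _
    constructor
    · rintro ⟨j, h, -⟩
      by_cases hji : j = i
      · subst hji; simpa using h
      · simp [hji] at h
    · intro h
      exact ⟨i, by simpa using h, fun j hj => by simp [hj]⟩

theorem cartesianLayer_apply (x : ∀ i, V i) (i : ι) (a : V i) :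
    cartesianLayer G x i a = Function.update x i a := rfl

variable {G}

/-- Layers are geodesically convex: the point `z` on a geodesic of a layer lies in that layer. -/
theorem eq_update_of_edist_add_eq (hconn : ∀ i, (G i).Connected) (x : ∀ i, V i) (i : ι) {a b : V i}
    {z : ∀ i, V i}
    (h : (cartesianProduct G).edist (Function.update x i a) z +
      (cartesianProduct G).edist z (Function.update x i b) =
      (cartesianProduct G).edist (Function.update x i a) (Function.update x i b)) :
    z = Function.update x i (z i) := by
  simp only [← (cartesianSplit G i).edist_apply] at h
  have hab := (cartesianSplit_snd_eq_iff G i (Function.update x i a) (Function.update x i b)).2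
    fun j hj => by simp [hj]
  have hz := (cartesianSplit_snd_eq_iff G i _ _).1 (snd_eq_of_edist_add_eq (hconn i) hab h)
  funext j
  by_cases hj : j = i
  · subst hj; simp
  · rw [hz j hj]; simp [hj]

/-- An automorphism maps a layer into a layer, possibly of another direction: the image is convex and
hence a box, and since `G i` is prime the box extends in only one direction. -/
theorem exists_layer_image (hconn : ∀ i, (G i).Connected) (hprime : ∀ i, (G i).IsCartesianPrime)
    (α : cartesianProduct G ≃g cartesianProduct G) (x : ∀ i, V i) (i : ι) :
    ∃ j, ∀ a, ∃ b, α (Function.update x i a) = Function.update (α x) j b := by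
  obtain ⟨a₁, a₂, hne⟩ := (hprime i).1
  -- The image is not a single vertex, so it extends in some direction `j`.
  obtain ⟨j, hj⟩ : ∃ j, α (Function.update x i a₁) j ≠ α (Function.update x i a₂) j :=
    Function.ne_iff.1 fun h => hne (Function.update_injective x i (α.injective h))
  let φ := cartesianSplit G j
  let f : G i ↪g G j □ cartesianQuotient G j :=
    φ.toEmbedding.comp (α.toEmbedding.comp (cartesianLayer G x i))
  have hf : ∀ a, f a = φ (α (Function.update x i a)) := fun _ => rfl
  have hmix : ∀ u v, ∃ w, f w = ((f u).1, (f v).2) := by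
    intro u v
    -- The mixed vertex is between `f u` and `f v`, so its preimage `z` is on a geodesic of the layer.
    let z := α.symm (φ.symm ((f u).1, (f v).2))
    have hz : φ (α z) = ((f u).1, (f v).2) := by simp [z]
    refine ⟨z i, ?_⟩
    rw [hf, ← eq_update_of_edist_add_eq hconn x i (a := u) (b := v), hz]
    simp only [← Iso.edist_apply (RelIso.trans α φ)]
    change (G j □ cartesianQuotient G j).edist (f u) (φ (α z)) +
      (G j □ cartesianQuotient G j).edist (φ (α z)) (f v) =
      (G j □ cartesianQuotient G j).edist (f u) (f v)
    rw [hz]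
    exact edist_boxProd_mix (f u) (f v)
  have hconst := ((hprime i).fst_or_snd_const f hmix).resolve_left fun h => hj (h a₁ a₂)
  refine ⟨j, fun a => ⟨α (Function.update x i a) j, funext fun l => ?_⟩⟩
  by_cases hl : l = j
  · subst hl; simp
  · have := (cartesianSplit_snd_eq_iff G j _ _).1 (hconst a (x i)) l hl
    simpa [hl, cartesianLayer_apply] using this

/-- Automorphisms preserve the direction of layers. Comparing with the inverse automorphism, the layer
in direction `i` is mapped onto one in direction `j`; this gives an isomorphism `G i ≃g G j`, so that
`i = j`. -/
theorem apply_update_eq (hconn : ∀ i, (G i).Connected) (hprime : ∀ i, (G i).IsCartesianPrime)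
    (hniso : ∀ i j, i ≠ j → IsEmpty (G i ≃g G j))
    (α : cartesianProduct G ≃g cartesianProduct G) (x : ∀ i, V i) (i : ι) (a : V i) :
    ∃ b, α (Function.update x i a) = Function.update (α x) i b := by
  obtain ⟨j, hj⟩ := exists_layer_image hconn hprime α x i
  obtain ⟨i', hi'⟩ := exists_layer_image hconn hprime α.symm (α x) j
  choose f hf using hj
  choose g hg using hi'
  simp only [RelIso.symm_apply_apply] at hg
  have hfg : ∀ a, Function.update x i a = Function.update x i' (g (f a)) := fun a => by
    rw [← hg, ← hf, RelIso.symm_apply_apply]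
  -- The layers in directions `i` and `i'` through `x` agree, and `G i` has two vertices.
  obtain rfl : i = i' := by
    by_contra hne
    obtain ⟨a₁, a₂, ha⟩ := (hprime i).1
    have h1 := congrFun (hfg a₁) i
    have h2 := congrFun (hfg a₂) i
    simp only [Function.update_self, Function.update_of_ne hne] at h1 h2
    exact ha (h1.trans h2.symm)
  have hgf : ∀ b, f (g b) = b := fun b =>
    Function.update_injective (α x) j (by rw [← hf, ← hg, RelIso.apply_symm_apply])
  have φ : G i ≃g G j :=
    { toFun := f
      invFun := g
      left_inv := fun a => (Function.update_injective x i (hfg a)).symm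
      right_inv := hgf
      map_rel_iff' := by
        intro a b
        change (G j).Adj (f a) (f b) ↔ _
        rw [← (cartesianLayer G (α x) j).map_adj_iff, ← (cartesianLayer G x i).map_adj_iff,
          cartesianLayer_apply, cartesianLayer_apply, ← hf, ← hf, α.map_adj_iff]
        rfl }
  obtain rfl : i = j := by
    by_contra hne
    exact (hniso i j hne).elim φ
  exact ⟨f a, hf a⟩

/-- The `i`-th coordinate of `α x` depends only on `x i`: the other coordinates of `x` can be changed
one at a time, and each change moves the image within a layer of a direction other than `i`. -/
theorem apply_coord_eq [Finite ι] (hconn : ∀ i, (G i).Connected)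
    (hprime : ∀ i, (G i).IsCartesianPrime) (hniso : ∀ i j, i ≠ j → IsEmpty (G i ≃g G j))
    (α : cartesianProduct G ≃g cartesianProduct G) (i : ι) (x y : ∀ i, V i) (hxy : x i = y i) :
    α x i = α y i := by
  have := Fintype.ofFinite ι
  have key : ∀ s : Finset ι, i ∉ s → α (s.piecewise y x) i = α x i := by
    intro s
    induction s using Finset.induction_on with
    | empty => simp
    | insert j s hjs ih =>
      intro hi
      rw [Finset.mem_insert, not_or] at hi
      obtain ⟨b, hb⟩ := apply_update_eq hconn hprime hniso α (s.piecewise y x) j (y j)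
      rw [Finset.piecewise_insert, hb, Function.update_of_ne hi.1, ih hi.2]
  have hy : (Finset.univ.erase i).piecewise y x = y := by
    funext j
    by_cases hj : j = i
    · subst hj; simp [hxy]
    · simp [hj]
  rw [← key (Finset.univ.erase i) (by simp), hy]

theorem exists_cartesianSplit_iso [Finite ι] [∀ i, Finite (V i)] (hconn : ∀ i, (G i).Connected)
    (hprime : ∀ i, (G i).IsCartesianPrime) (hniso : ∀ i j, i ≠ j → IsEmpty (G i ≃g G j))
    (α : cartesianProduct G ≃g cartesianProduct G) (i : ι) :
    ∃ (β : G i ≃g G i) (γ : cartesianQuotient G i ≃g cartesianQuotient G i), ∀ x,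
      cartesianSplit G i (α x) = (β (cartesianSplit G i x).1, γ (cartesianSplit G i x).2) := by
  have : ∀ i, Nonempty (V i) := fun i => (hconn i).nonempty
  refine exists_boxProd_iso (cartesianSplit G i) α
    (apply_coord_eq hconn hprime hniso α i) fun x y hxy => ?_
  rw [cartesianSplit_snd_eq_iff] at hxy ⊢
  intro j hj
  have hy : y = Function.update x i (y i) := by
    funext l
    by_cases hl : l = i
    · subst hl; simp
    · simp [hl, hxy l hl]
  obtain ⟨b, hb⟩ := apply_update_eq hconn hprime hniso α x i (y i)
  rw [hy, hb, Function.update_of_ne hj]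

theorem exists_edgeCycles_le [Finite ι] [∀ i, Finite (V i)] (hconn : ∀ i, (G i).Connected)
    (hprime : ∀ i, (G i).IsCartesianPrime) (hniso : ∀ i j, i ≠ j → IsEmpty (G i ≃g G j))
    (α : cartesianProduct G ≃g cartesianProduct G)
    (hα : α ≠ RelIso.refl (cartesianProduct G).Adj) :
    ∃ n ∈ factorCycleCounts G, edgeCycles α ≤ n := by
  obtain ⟨x, i, hx⟩ : ∃ x i, α x i ≠ x i := by
    by_contra! h
    exact hα (RelIso.ext fun x => funext (h x))
  obtain ⟨β, γ, h⟩ := exists_cartesianSplit_iso hconn hprime hniso α i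
  refine ⟨_, ⟨i, β, ?_, rfl⟩, edgeCycles_le_of_boxProd (cartesianSplit G i) α β γ h⟩
  rintro rfl
  exact hx (congrArg Prod.fst (h x))

theorem exists_le_edgeCycles [Finite ι] [∀ i, Finite (V i)] (hconn : ∀ i, (G i).Connected)
    {n : ℕ} (hn : n ∈ factorCycleCounts G) :
    ∃ α : cartesianProduct G ≃g cartesianProduct G,
      α ≠ RelIso.refl (cartesianProduct G).Adj ∧ n ≤ edgeCycles α := by
  obtain ⟨i, β, hβ, rfl⟩ := hn
  have h := apply_boxProdFstIso (cartesianSplit G i) β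
  refine ⟨_, fun hα => hβ (RelIso.ext fun a => ?_),
    le_edgeCycles_of_boxProd (cartesianSplit G i) _ β h⟩
  have : ∀ i, Nonempty (V i) := fun i => (hconn i).nonempty
  obtain ⟨x⟩ : Nonempty (∀ i, V i) := inferInstance
  have hx := congrArg Prod.fst (h (Function.update x i a))
  rw [hα] at hx
  simpa [cartesianSplit_fst] using hx.symm

end Family

end SimpleGraph

/-- The supremum is taken in `ℕ`: it is the maximum of the finite set of values, and it is `0` if no
factor has a non-identity automorphism. -/
theorem theorem5p1 (k : ℕ) (hk : 2 ≤ k) (V : Fin k → Type*) [∀ i, Finite (V i)]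
    (G : ∀ i, SimpleGraph (V i))
    (hconn : ∀ i, (G i).Connected)
    (hprime : ∀ i, (G i).IsCartesianPrime)
    (hniso : ∀ i j, i ≠ j → IsEmpty (G i ≃g G j)) :
    (SimpleGraph.cartesianProduct G).edgeDistinguishingThreshold =
      sSup (SimpleGraph.factorCycleCounts G) + 1 := by
  have hbdd := (SimpleGraph.factorCycleCounts_finite G).bddAbove
  refine SimpleGraph.edgeDistinguishingThreshold_eq _ _ (fun α hα => ?_) fun h0 => ?_
  · obtain ⟨n, hn, hle⟩ := SimpleGraph.exists_edgeCycles_le hconn hprime hniso α hα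
    exact hle.trans (le_csSup hbdd hn)
  · refine SimpleGraph.exists_le_edgeCycles hconn (Nat.sSup_mem ?_ hbdd)
    by_contra h
    rw [Set.not_nonempty_iff_eq_empty] at h
    simp [h] at h0
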